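/- Let $\mathcal{A}$ be a complex unital Banach algebra. An element $a\in\mathcal{A}$ is called generalized Drazin invertible, written $a\in\mathcal{A}^d$, if there is an element $a^d\in\mathcal{A}$ (necessarily unique) such that $$a^d a a^d=a^d,\qquad a a^d=a^d a,\qquad a-a^2a^d \text{ is quasinilpotent},$$ where an element is quasinilpotent if its spectral radius is $0$. For $a\in\mathcal{A}^d$ put $a^\pi=1-aa^d$. Let $a,b\in\mathcal{A}^d$ with $b a^\pi=0$, and let $c=aa^d(a+b)$. Then $$a+b\in\mathcal{A}^d\iff c\in\mathcal{A}^d\iff a^2a^d+b\in\mathcal{A}^d.$$ If these equivalent conditions hold, then the series below converges in $\mathcal{A}$ (unconditionally) and $$(a+b)^d=c^d+\sum_{n=0}^{\infty}a^n a^\pi b\,(c^d)^{n+2}.$$ -/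

import Mathlib

open Filter Topology

noncomputable section

/-- `x` is quasinilpotent: its spectral radius (the supremum of `|z|` over the complex
spectrum) is zero. -/
def IsQuasinilpotent {A : Type*} [NormedRing A] [NormedAlgebra ℂ A] (x : A) : Prop :=
  spectralRadius ℂ x = 0

/-- `x` is a generalized Drazin (Koliha–Drazin) inverse of `a`. -/
structure IsGDrazinInverse {A : Type*} [NormedRing A] [NormedAlgebra ℂ A] (a x : A) : Prop where
  inner_eq : x * a * x = x
  comm : a * x = x * a
  quasinilpotent : IsQuasinilpotent (a - a ^ 2 * x)

/-- `a` is generalized Drazin invertible. -/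
def IsGDrazinInvertible {A : Type*} [NormedRing A] [NormedAlgebra ℂ A] (a : A) : Prop :=
  ∃ x : A, IsGDrazinInverse a x

open Classical in
/-- The generalized Drazin inverse of `a` (with the value `0` when `a` has none); it is unique by
`IsGDrazinInverse.unique` below. -/
def gDrazinInv {A : Type*} [NormedRing A] [NormedAlgebra ℂ A] (a : A) : A :=
  if h : IsGDrazinInvertible a then h.choose else 0

/-- The spectral idempotent `1 - a a^d` of `a` corresponding to `{0}`. -/
def spectralIdem {A : Type*} [NormedRing A] [NormedAlgebra ℂ A] (a : A) : A :=
  1 - a * gDrazinInv a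

theorem IsQuasinilpotent.tendsto {A : Type*} [NormedRing A] [NormedAlgebra ℂ A] [CompleteSpace A]
    {q : A} (hq : IsQuasinilpotent q) (C : ℝ) (hC : 0 ≤ C) :
    Tendsto (fun n : ℕ => C ^ n * ‖q ^ n‖) atTop (𝓝 0) := by
  have h := spectrum.pow_norm_pow_one_div_tendsto_nhds_spectralRadius q
  rw [show spectralRadius ℂ q = 0 from hq] at h
  have hpos : (0 : ENNReal) < ENNReal.ofReal (1 / (2 * (C + 1))) := by
    rw [ENNReal.ofReal_pos]; positivity
  have hev := h.eventually (gt_mem_nhds hpos)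
  have hgeo : Tendsto (fun n : ℕ => (1 / 2 : ℝ) ^ n) atTop (𝓝 0) :=
    tendsto_pow_atTop_nhds_zero_of_lt_one (by norm_num) (by norm_num)
  refine squeeze_zero' (Eventually.of_forall fun n => by positivity) ?_ hgeo
  filter_upwards [hev, eventually_gt_atTop 0] with n hn hn0
  have h1 : ‖q ^ n‖ ^ (1 / n : ℝ) < 1 / (2 * (C + 1)) :=
    (ENNReal.ofReal_lt_ofReal_iff (by positivity)).1 hn
  have h2 : ‖q ^ n‖ ≤ (1 / (2 * (C + 1))) ^ n := by
    have h3 := pow_le_pow_left₀ (by positivity) h1.le n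
    rwa [← Real.rpow_natCast (‖q ^ n‖ ^ (1 / n : ℝ)) n, ← Real.rpow_mul (norm_nonneg _),
      one_div_mul_cancel (by exact_mod_cast hn0.ne'), Real.rpow_one] at h3
  calc C ^ n * ‖q ^ n‖ ≤ C ^ n * (1 / (2 * (C + 1))) ^ n := by gcongr
    _ = (C * (1 / (2 * (C + 1)))) ^ n := (mul_pow _ _ _).symm
    _ ≤ (1 / 2) ^ n := by
      gcongr
      rw [mul_one_div, div_le_div_iff₀ (by positivity) (by norm_num)]
      linarith

theorem IsQuasinilpotent.eq_zero_of_eq {A : Type*} [NormedRing A] [NormedAlgebra ℂ A]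
    [CompleteSpace A] {q x z : A} (hq : IsQuasinilpotent q)
    (h : ∀ n : ℕ, 0 < n → z = x ^ n * q ^ n ∨ z = q ^ n * x ^ n) : z = 0 := by
  rw [← norm_le_zero_iff]
  refine ge_of_tendsto (hq.tendsto ‖x‖ (norm_nonneg _)) ?_
  filter_upwards [eventually_gt_atTop 0] with n hn
  have hx := norm_pow_le' x hn
  rcases h n hn with h | h
  · rw [h]
    exact (norm_mul_le _ _).trans (by gcongr)
  · rw [h, mul_comm]
    exact (norm_mul_le _ _).trans (by gcongr)

theorem IsGDrazinInverse.unique {A : Type*} [NormedRing A] [NormedAlgebra ℂ A] [CompleteSpace A]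
    {a x y : A} (hx : IsGDrazinInverse a x) (hy : IsGDrazinInverse a y) : x = y := by
  have pw : ∀ {w : A}, IsGDrazinInverse a w → ∀ n : ℕ, 0 < n →
      a ^ n * w ^ n = a * w ∧ w ^ n * a ^ n = a * w ∧
        (a - a ^ 2 * w) ^ n = a ^ n * (1 - a * w) ∧ (a - a ^ 2 * w) ^ n = (1 - a * w) * a ^ n := by
    intro w hw n hn
    have hc : Commute a w := hw.comm
    have hid : IsIdempotentElem (a * w) := by
      rw [IsIdempotentElem, mul_assoc, ← mul_assoc w, hw.inner_eq]
    have hc' : Commute a (1 - a * w) :=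
      (Commute.one_right a).sub_right ((Commute.refl a).mul_right hc)
    have e : a - a ^ 2 * w = a * (1 - a * w) := by noncomm_ring
    have h1 : a ^ n * w ^ n = a * w := by rw [← hc.mul_pow, hid.pow_eq hn.ne']
    have h3 : (a - a ^ 2 * w) ^ n = a ^ n * (1 - a * w) := by
      rw [e, hc'.mul_pow, hid.one_sub.pow_eq hn.ne']
    exact ⟨h1, by rw [← (hc.pow_pow n n).eq, h1], h3, by rw [h3, (hc'.pow_left n).eq]⟩
  have h1 : a * x * (1 - a * y) = 0 := by
    refine hy.quasinilpotent.eq_zero_of_eq (x := x) fun n hn => Or.inl ?_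
    rw [(pw hy n hn).2.2.1, ← mul_assoc, (pw hx n hn).2.1]
  have h2 : (1 - a * x) * (a * y) = 0 := by
    refine hx.quasinilpotent.eq_zero_of_eq (x := y) fun n hn => Or.inr ?_
    rw [(pw hx n hn).2.2.2, mul_assoc, (pw hy n hn).1]
  have h3 : a * x = a * y := by
    rw [mul_sub, mul_one, sub_eq_zero] at h1
    rw [sub_mul, one_mul, sub_eq_zero] at h2
    rw [h1, ← h2]
  calc x = x * (a * x) := by rw [← mul_assoc, hx.inner_eq]
    _ = x * a * y := by rw [h3, mul_assoc]
    _ = y * a * y := by rw [← hx.comm, h3, hy.comm]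
    _ = y := hy.inner_eq

theorem gDrazinInv_eq {A : Type*} [NormedRing A] [NormedAlgebra ℂ A] [CompleteSpace A]
    {a x : A} (hx : IsGDrazinInverse a x) : gDrazinInv a = x := by
  have h : IsGDrazinInvertible a := ⟨x, hx⟩
  rw [gDrazinInv, dif_pos h]
  exact h.choose_spec.unique hx

end

/-!
Put `p = a a^d`, so that `b p = b` and `a (1 - p)` is quasinilpotent. Then `t = a² a^d + b` equals
`(a + b) p`, while `c = p (a + b)`: by Cline's formula these are generalized Drazin invertible
together, with `t^d = (a + b) (c^d)² p`. Moreover `a + b = t + a (1 - p)` with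
`t * (a (1 - p)) = 0`, and adding a quasinilpotent `y` with `x y = 0` to `x` does not affect
generalized Drazin invertibility. Indeed `(x + y)^d` is the solution `S = ∑ yⁿ (x^d)ⁿ⁺¹` of
`S = x^d + y S x^d`, the series converging because `y` is quasinilpotent; conversely
`x^d = x ((x + y)^d)²`, because `(x + y)^d y = 0`.
-/

theorem mul_mul_mul_one_sub_eq_zero {R : Type*} [Ring R] {p s : R} (hps : p * s * p = p * s) :
    s * p * (s * (1 - p)) = 0 := by
  rw [mul_assoc, ← mul_assoc p, mul_sub, mul_one, hps, sub_self, mul_zero]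

theorem add_mul_fixedPoint {R : Type*} [Ring R] {x y d S : R} (hxy : x * y = 0)
    (hS : S = d + y * S * d) : (x + y) * S = x * d + y * S := by
  have hxS : x * S = x * d := by
    rw [hS, mul_add, mul_assoc y, ← mul_assoc x y, hxy, zero_mul, add_zero]
  rw [add_mul, hxS]

section Quasinilpotent

variable {A : Type*} [NormedRing A] [NormedAlgebra ℂ A] {x y : A}

theorem isQuasinilpotent_iff_units_notMem_spectrum :
    IsQuasinilpotent x ↔ ∀ r : ℂˣ, (r : ℂ) ∉ spectrum ℂ x := by
  have hzero : IsQuasinilpotent x ↔ ∀ k ∈ spectrum ℂ x, k = 0 := by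
    simp [IsQuasinilpotent, spectralRadius]
  rw [hzero]
  exact ⟨fun h r hr => r.ne_zero (h r hr),
    fun h k hk => by_contra fun hk0 => h (Units.mk0 k hk0) hk⟩

theorem isQuasinilpotent_mul_comm : IsQuasinilpotent (x * y) ↔ IsQuasinilpotent (y * x) := by
  simp only [isQuasinilpotent_iff_units_notMem_spectrum, spectrum.unit_mem_mul_comm]

theorem isQuasinilpotent_add_iff_left (hxy : x * y = 0) (hy : IsQuasinilpotent y) :
    IsQuasinilpotent (x + y) ↔ IsQuasinilpotent x := by
  simp only [isQuasinilpotent_iff_units_notMem_spectrum, spectrum.notMem_iff,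
    Algebra.algebraMap_eq_smul_one] at hy ⊢
  refine forall_congr' fun r => ?_
  have hfactor : r • ((r : ℂ) • (1 : A) - (x + y)) =
      ((r : ℂ) • 1 - x) * ((r : ℂ) • 1 - y) := by
    simp only [Units.smul_def, sub_mul, mul_sub, smul_mul_assoc, mul_smul_comm, one_mul, mul_one,
      hxy, smul_sub, smul_add]
    abel
  obtain ⟨v, hv⟩ := hy r
  rw [← Units.isUnit_mul_units (_ - x) v, hv, ← hfactor, isUnit_smul_iff]

variable [CompleteSpace A]

theorem IsQuasinilpotent.summable_pow_mul_mul_pow (hx : IsQuasinilpotent x) (u d : A) :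
    Summable fun n : ℕ => x ^ n * u * d ^ n := by
  have hgeo : Summable fun n : ℕ => (1 / 2 : ℝ) ^ n * ‖u‖ :=
    summable_geometric_two.mul_right _
  refine hgeo.of_norm_bounded_eventually_nat ?_
  filter_upwards [(hx.tendsto (2 * ‖d‖) (by positivity)).eventually (gt_mem_nhds one_pos),
    eventually_gt_atTop 0] with n hlt hn
  have hdecay : ‖x ^ n‖ * ‖d‖ ^ n ≤ (1 / 2) ^ n := by
    rw [one_div, inv_pow, ← one_div, le_div_iff₀ (by positivity)]
    rw [mul_pow] at hlt
    linarith
  calc ‖x ^ n * u * d ^ n‖ ≤ ‖x ^ n‖ * ‖u‖ * ‖d‖ ^ n :=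
        norm_mul_le_of_le (norm_mul_le _ _) (norm_pow_le' d hn)
    _ = ‖x ^ n‖ * ‖d‖ ^ n * ‖u‖ := by ring
    _ ≤ (1 / 2) ^ n * ‖u‖ := by gcongr

theorem IsQuasinilpotent.tsum_pow_mul_mul_pow_eq (hx : IsQuasinilpotent x) (u d : A) :
    ∑' n : ℕ, x ^ n * u * d ^ n = u + x * (∑' n : ℕ, x ^ n * u * d ^ n) * d := by
  have hsum := hx.summable_pow_mul_mul_pow u d
  conv_lhs => rw [hsum.tsum_eq_zero_add]
  rw [← hsum.tsum_mul_left, ← (hsum.mul_left x).tsum_mul_right]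
  simp only [pow_zero, one_mul, mul_one, pow_succ' x, pow_succ d, mul_assoc]

theorem IsQuasinilpotent.mul_eq_zero_of_eq_sq_mul_sq {w : A} (hy : IsQuasinilpotent y)
    (h : w * y = w ^ 2 * y ^ 2) : w * y = 0 := by
  have hpow : ∀ n : ℕ, w * y = w ^ (n + 1) * y ^ (n + 1) := by
    intro n
    induction n with
    | zero => simp only [zero_add, pow_one]
    | succ n ih =>
      calc w * y = w ^ (n + 1) * y ^ (n + 1) := ih
        _ = w ^ n * (w * y) * y ^ n := by simp only [pow_succ w, pow_succ' y, mul_assoc]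
        _ = w ^ n * (w ^ 2 * y ^ 2) * y ^ n := by rw [h]
        _ = w ^ (n + 2) * y ^ (2 + n) := by simp only [pow_add, mul_assoc]
        _ = w ^ (n + 1 + 1) * y ^ (n + 1 + 1) := by rw [add_comm 2 n]
  refine hy.eq_zero_of_eq (x := w) fun n hn => Or.inl ?_
  rw [hpow (n - 1), Nat.sub_add_cancel hn]

end Quasinilpotent

namespace IsGDrazinInverse

variable {A : Type*} [NormedRing A] [NormedAlgebra ℂ A] {x y d p s S X : A}

theorem sq_mul (h : IsGDrazinInverse x d) : d ^ 2 * x = d := by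
  rw [sq, mul_assoc, ← h.comm, ← mul_assoc, h.inner_eq]

theorem mul_sq (h : IsGDrazinInverse x d) : x * d ^ 2 = d := by
  rw [sq, ← mul_assoc, h.comm, h.inner_eq]

theorem isIdempotentElem_mul (h : IsGDrazinInverse x d) : IsIdempotentElem (x * d) := by
  rw [IsIdempotentElem, mul_assoc, ← mul_assoc d, h.inner_eq]

/-- Cline's formula. -/
theorem mul_swap (h : IsGDrazinInverse (x * y) d) :
    IsGDrazinInverse (y * x) (y * d ^ 2 * x) := by
  have hright : y * x * (y * d ^ 2 * x) = y * d * x :=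
    calc y * x * (y * d ^ 2 * x) = y * (x * y * d ^ 2) * x := by simp only [mul_assoc]
      _ = y * d * x := by rw [h.mul_sq]
  have hleft : y * d ^ 2 * x * (y * x) = y * d * x :=
    calc y * d ^ 2 * x * (y * x) = y * (d ^ 2 * (x * y)) * x := by simp only [mul_assoc]
      _ = y * d * x := by rw [h.sq_mul]
  refine ⟨?_, hright.trans hleft.symm, ?_⟩
  · calc y * d ^ 2 * x * (y * x) * (y * d ^ 2 * x) = y * d * x * (y * d ^ 2 * x) := by rw [hleft]
      _ = y * (d * (x * y * d ^ 2)) * x := by simp only [mul_assoc]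
      _ = y * d ^ 2 * x := by rw [h.mul_sq, sq]
  · have hres : y * x - (y * x) ^ 2 * (y * d ^ 2 * x) = y * ((1 - x * y * d) * x) := by
      rw [sq, mul_assoc (y * x), hright]
      noncomm_ring
    have hswap : (1 - x * y * d) * x * y = x * y - (x * y) ^ 2 * d := by
      rw [mul_assoc, sub_mul, one_mul, mul_assoc (x * y), ← h.comm, ← mul_assoc, sq]
    rw [hres, isQuasinilpotent_mul_comm, hswap]
    exact h.quasinilpotent

theorem mul_eq_self_of_isIdempotentElem (h : IsGDrazinInverse (p * s) d)
    (hp : IsIdempotentElem p) : p * d = d := by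
  rw [← h.mul_sq, ← mul_assoc, ← mul_assoc, hp.eq]

theorem mul_eq_zero_of_mul_eq_zero (h : IsGDrazinInverse x d) (hxy : x * y = 0) : d * y = 0 := by
  rw [← h.sq_mul, mul_assoc, hxy, mul_zero]

theorem fixedPoint_mul_eq_zero (h : IsGDrazinInverse x d) (hxy : x * y = 0)
    (hS : S = d + y * S * d) : S * y = 0 := by
  rw [hS, add_mul, mul_assoc _ d, h.mul_eq_zero_of_mul_eq_zero hxy, mul_zero, add_zero]

theorem fixedPoint_mul_add (h : IsGDrazinInverse x d) (hxy : x * y = 0)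
    (hS : S = d + y * S * d) : S * (x + y) = x * d + y * S := by
  have hSdx : S * d * x = S :=
    calc S * d * x = (d + y * S * d) * d * x := by rw [← hS]
      _ = d ^ 2 * x + y * S * (d ^ 2 * x) := by simp only [add_mul, mul_assoc, sq]
      _ = S := by rw [h.sq_mul, ← hS]
  calc S * (x + y) = S * x := by rw [mul_add, h.fixedPoint_mul_eq_zero hxy hS, add_zero]
    _ = (d + y * S * d) * x := by rw [← hS]
    _ = d * x + y * (S * d * x) := by simp only [add_mul, mul_assoc]
    _ = x * d + y * S := by rw [hSdx, h.comm]

theorem add_of_fixedPoint (h : IsGDrazinInverse x d) (hxy : x * y = 0)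
    (hy : IsQuasinilpotent y) (hS : S = d + y * S * d) : IsGDrazinInverse (x + y) S := by
  have hdy : d * y = 0 := h.mul_eq_zero_of_mul_eq_zero hxy
  have hSy : S * y = 0 := h.fixedPoint_mul_eq_zero hxy hS
  have hleft : S * (x + y) = x * d + y * S := h.fixedPoint_mul_add hxy hS
  have hright : (x + y) * S = x * d + y * S := add_mul_fixedPoint hxy hS
  refine ⟨?_, hright.trans hleft.symm, ?_⟩
  · calc S * (x + y) * S = S * (x * d + y * S) := by rw [mul_assoc, hright]
      _ = S * (x + y) * d := by rw [mul_add, mul_add, add_mul, ← mul_assoc S y, hSy, zero_mul,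
          zero_mul, add_zero, add_zero, mul_assoc]
      _ = d * x * d + y * S * d := by rw [hleft, add_mul, h.comm]
      _ = S := by rw [h.inner_eq, ← hS]
  · have hxyS : x * (y * S) = 0 := by rw [← mul_assoc, hxy, zero_mul]
    have hsplit : x + y - (x + y) ^ 2 * S = (x - x ^ 2 * d) + y * (1 - (x * d + y * S)) := by
      rw [sq (x + y), mul_assoc, hright, add_mul x y, mul_add x, hxyS]
      noncomm_ring
    have hzero : (x - x ^ 2 * d) * (y * (1 - (x * d + y * S))) = 0 := by
      rw [← mul_assoc, sub_mul, mul_assoc _ d, hdy, hxy, mul_zero, sub_zero, zero_mul]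
    have hlower : (1 - (x * d + y * S)) * y = y := by
      rw [sub_mul, add_mul, mul_assoc x, hdy, mul_assoc y, hSy]
      simp only [mul_zero, add_zero, one_mul, sub_zero]
    rw [hsplit, isQuasinilpotent_add_iff_left hzero
      (isQuasinilpotent_mul_comm.2 (hlower.symm ▸ hy))]
    exact h.quasinilpotent

/-- Along `p`, the element `s` is block triangular with diagonal blocks `p * s` and `s * (1 - p)`;
the Sylvester equation `hX` determines the off-diagonal block `X` of its inverse. -/
theorem of_triangular (hp : IsIdempotentElem p) (hps : p * s * p = p * s)
    (hq : IsQuasinilpotent (s * (1 - p))) (h : IsGDrazinInverse (p * s) d)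
    (hX : X = (1 - p) * s * d ^ 2 + s * (1 - p) * X * d) : IsGDrazinInverse s (d + X) := by
  have hpd : p * d = d := h.mul_eq_self_of_isIdempotentElem hp
  have hdp : d * p = d := by rw [← h.sq_mul, mul_assoc, hps]
  have hdsd : d * s * d = d := by simpa only [← mul_assoc, hdp] using h.inner_eq
  have hcline : IsGDrazinInverse (s * p) (s * d ^ 2) := by
    have hmul := h.mul_swap
    rwa [mul_assoc s, sq, mul_assoc d, hdp, ← sq] at hmul
  have hXsd : X * s * d = X :=
    calc X * s * d = ((1 - p) * s * d ^ 2 + s * (1 - p) * X * d) * s * d := by rw [← hX]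
      _ = (1 - p) * s * d * (d * s * d) + s * (1 - p) * X * (d * s * d) := by
        simp only [add_mul, mul_assoc, sq]
      _ = X := by rw [hdsd, mul_assoc _ d d, ← sq, ← hX]
  have hfix : d + X = s * d ^ 2 + s * (1 - p) * (d + X) * (s * d ^ 2) :=
    calc d + X = p * s * d ^ 2 + ((1 - p) * s * d ^ 2 + s * (1 - p) * X * d) := by
          rw [← hX, h.mul_sq]
      _ = s * d ^ 2 + s * (d - p * d + (1 - p) * X) * d := by
        rw [hpd]
        noncomm_ring
      _ = s * d ^ 2 + s * (1 - p) * (d * s * d + X * s * d) * d := by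
        rw [hdsd, hXsd]
        noncomm_ring
      _ = s * d ^ 2 + s * (1 - p) * (d + X) * (s * d ^ 2) := by
        simp only [add_mul, mul_add, mul_assoc, sq]
  have hadd := hcline.add_of_fixedPoint (mul_mul_mul_one_sub_eq_zero hps) hq hfix
  rwa [← mul_add, add_sub_cancel, mul_one] at hadd

theorem commute_one_sub (h : IsGDrazinInverse x d) : Commute x (1 - x * d) :=
  (Commute.one_right x).sub_right ((Commute.refl x).mul_right h.comm)

theorem isQuasinilpotent_mul_one_sub (h : IsGDrazinInverse x d) :
    IsQuasinilpotent (x * (1 - x * d)) := by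
  have hres : x * (1 - x * d) = x - x ^ 2 * d := by noncomm_ring
  exact hres ▸ h.quasinilpotent

variable [CompleteSpace A]

theorem of_add {w : A} (h : IsGDrazinInverse (x + y) w) (hxy : x * y = 0)
    (hy : IsQuasinilpotent y) : IsGDrazinInverse x (x * w ^ 2) := by
  have hwy : w * y = 0 := by
    refine hy.mul_eq_zero_of_eq_sq_mul_sq ?_
    have hsy : (x + y) * y = y ^ 2 := by rw [add_mul, hxy, zero_add, sq]
    rw [← hsy, ← mul_assoc, h.sq_mul]
  have hwx : w * x = w * (x + y) := by rw [mul_add, hwy, add_zero]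
  have hxxw : x * x * w = x * (x + y) * w := by rw [mul_add, hxy, add_zero]
  have hright : x * (x * w ^ 2) = x * w := by
    rw [sq, ← mul_assoc, ← mul_assoc, hxxw, mul_assoc x, mul_assoc x, mul_assoc _ w, ← sq, h.mul_sq]
  have hleft : x * w ^ 2 * x = x * w := by
    rw [mul_assoc, sq, mul_assoc w, hwx, ← mul_assoc w, ← sq, h.sq_mul]
  refine ⟨?_, hright.trans hleft.symm, ?_⟩
  · calc x * w ^ 2 * x * (x * w ^ 2) = x * w * (x * w ^ 2) := by rw [hleft]
      _ = x * (w * x * w) * w := by simp only [sq, mul_assoc]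
      _ = x * (w * (x + y) * w) * w := by rw [hwx]
      _ = x * w ^ 2 := by rw [h.inner_eq, mul_assoc, sq]
  · have hres : x - x ^ 2 * (x * w ^ 2) = x * (1 - (x + y) * w) := by
      rw [sq, mul_assoc x x, hright, ← mul_assoc, hxxw, mul_sub, mul_one, mul_assoc]
    have hupper : (1 - (x + y) * w) * x + y = x + y - (x + y) ^ 2 * w := by
      rw [sub_mul, one_mul, mul_assoc, hwx, ← h.comm, ← mul_assoc, ← sq]
      abel
    rw [hres, isQuasinilpotent_mul_comm,
      ← isQuasinilpotent_add_iff_left (by rw [mul_assoc, hxy, mul_zero]) hy, hupper]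
    exact h.quasinilpotent

end IsGDrazinInverse

section Invertible

variable {A : Type*} [NormedRing A] [NormedAlgebra ℂ A] {x y p s : A}

theorem isGDrazinInvertible_mul_comm :
    IsGDrazinInvertible (x * y) ↔ IsGDrazinInvertible (y * x) :=
  ⟨fun ⟨_, h⟩ => ⟨_, h.mul_swap⟩, fun ⟨_, h⟩ => ⟨_, h.mul_swap⟩⟩

theorem IsGDrazinInvertible.isGDrazinInverse_gDrazinInv (h : IsGDrazinInvertible x) :
    IsGDrazinInverse x (gDrazinInv x) := by
  rw [gDrazinInv, dif_pos h]
  exact h.choose_spec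

variable [CompleteSpace A]

theorem isGDrazinInvertible_add_iff_left (hxy : x * y = 0) (hy : IsQuasinilpotent y) :
    IsGDrazinInvertible (x + y) ↔ IsGDrazinInvertible x :=
  ⟨fun ⟨_, h⟩ => ⟨_, h.of_add hxy hy⟩,
    fun ⟨d, h⟩ => ⟨_, h.add_of_fixedPoint hxy hy (hy.tsum_pow_mul_mul_pow_eq d d)⟩⟩

theorem isGDrazinInvertible_iff_of_triangular (hps : p * s * p = p * s)
    (hq : IsQuasinilpotent (s * (1 - p))) :
    IsGDrazinInvertible s ↔ IsGDrazinInvertible (p * s) := by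
  have hsplit : s * p + s * (1 - p) = s := by rw [← mul_add, add_sub_cancel, mul_one]
  rw [← isGDrazinInvertible_mul_comm,
    ← isGDrazinInvertible_add_iff_left (mul_mul_mul_one_sub_eq_zero hps) hq, hsplit]

end Invertible

section Perturbation

variable {A : Type*} [NormedRing A] [NormedAlgebra ℂ A] {a b x d : A}

theorem IsGDrazinInverse.mul_add_mul_eq (h : IsGDrazinInverse a x) (hb : b * (1 - a * x) = 0) :
    a * x * (a + b) * (a * x) = a * x * (a + b) := by
  have hzero : a * x * ((a + b) * (1 - a * x)) = 0 := by
    rw [add_mul, hb, add_zero, h.commute_one_sub.eq, ← mul_assoc,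
      h.isIdempotentElem_mul.mul_one_sub_self, zero_mul]
  rwa [← mul_assoc, mul_sub, mul_one, sub_eq_zero, eq_comm] at hzero

theorem IsGDrazinInverse.isQuasinilpotent_add_mul_one_sub (h : IsGDrazinInverse a x)
    (hb : b * (1 - a * x) = 0) : IsQuasinilpotent ((a + b) * (1 - a * x)) := by
  rw [add_mul, hb, add_zero]
  exact h.isQuasinilpotent_mul_one_sub

theorem IsGDrazinInverse.pow_mul_one_sub_mul_pow (h : IsGDrazinInverse a x) (b d : A) (n : ℕ) :
    a ^ n * (1 - a * x) * b * d ^ (n + 2) =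
      (a * (1 - a * x)) ^ n * ((1 - a * x) * b * d ^ 2) * d ^ n := by
  have hpow : (a * (1 - a * x)) ^ n * (1 - a * x) = a ^ n * (1 - a * x) := by
    rw [h.commute_one_sub.mul_pow, mul_assoc, ← pow_succ,
      h.isIdempotentElem_mul.one_sub.pow_succ_eq]
  rw [← hpow, add_comm n 2, pow_add]
  simp only [mul_assoc]

variable [CompleteSpace A]

theorem IsGDrazinInverse.summable_pow_mul_one_sub_mul_pow (h : IsGDrazinInverse a x) (b d : A) :
    Summable fun n : ℕ => a ^ n * (1 - a * x) * b * d ^ (n + 2) := by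
  simp only [h.pow_mul_one_sub_mul_pow]
  exact h.isQuasinilpotent_mul_one_sub.summable_pow_mul_mul_pow _ d

theorem IsGDrazinInverse.add_of_mul_one_sub_eq_zero (h : IsGDrazinInverse a x)
    (hb : b * (1 - a * x) = 0) (hd : IsGDrazinInverse (a * x * (a + b)) d) :
    IsGDrazinInverse (a + b) (d + ∑' n : ℕ, a ^ n * (1 - a * x) * b * d ^ (n + 2)) := by
  have hcorner : (1 - a * x) * (a + b) * d ^ 2 = (1 - a * x) * b * d ^ 2 := by
    have had : (1 - a * x) * a * d = 0 := by
      rw [← h.commute_one_sub.eq, mul_assoc, sub_mul, one_mul,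
        hd.mul_eq_self_of_isIdempotentElem h.isIdempotentElem_mul, sub_self, mul_zero]
    rw [mul_add, add_mul, sq, ← mul_assoc _ d, had, zero_mul, zero_add]
  refine hd.of_triangular h.isIdempotentElem_mul (h.mul_add_mul_eq hb)
    (h.isQuasinilpotent_add_mul_one_sub hb) ?_
  rw [hcorner, add_mul a b, hb, add_zero]
  simp only [h.pow_mul_one_sub_mul_pow]
  exact h.isQuasinilpotent_mul_one_sub.tsum_pow_mul_mul_pow_eq _ d

end Perturbation

theorem corollary2p3_general {A : Type*} [NormedRing A] [NormedAlgebra ℂ A] [CompleteSpace A]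
    (a b c : A) (ha : IsGDrazinInvertible a)
    (hba : b * spectralIdem a = 0) (hc : c = a * gDrazinInv a * (a + b)) :
    (IsGDrazinInvertible (a + b) ↔ IsGDrazinInvertible c) ∧
    (IsGDrazinInvertible c ↔ IsGDrazinInvertible (a ^ 2 * gDrazinInv a + b)) ∧
    (IsGDrazinInvertible (a + b) →
      Summable (fun n : ℕ => a ^ n * spectralIdem a * b * gDrazinInv c ^ (n + 2)) ∧
      gDrazinInv (a + b) = gDrazinInv c +
        ∑' n : ℕ, a ^ n * spectralIdem a * b * gDrazinInv c ^ (n + 2)) := by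
  subst hc
  have h := ha.isGDrazinInverse_gDrazinInv
  have hiff : IsGDrazinInvertible (a + b) ↔ IsGDrazinInvertible (a * gDrazinInv a * (a + b)) :=
    isGDrazinInvertible_iff_of_triangular (h.mul_add_mul_eq hba)
      (h.isQuasinilpotent_add_mul_one_sub hba)
  have hcore : a ^ 2 * gDrazinInv a + b = (a + b) * (a * gDrazinInv a) := by
    have hb : b * (a * gDrazinInv a) = b := by
      rwa [spectralIdem, mul_sub, mul_one, sub_eq_zero, eq_comm] at hba
    rw [add_mul, hb, sq, mul_assoc]
  refine ⟨hiff, hcore ▸ isGDrazinInvertible_mul_comm, fun hab => ?_⟩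
  have hd := (hiff.1 hab).isGDrazinInverse_gDrazinInv
  exact ⟨h.summable_pow_mul_one_sub_mul_pow b _,
    gDrazinInv_eq (h.add_of_mul_one_sub_eq_zero hba hd)⟩

theorem corollary2p3 {A : Type*} [NormedRing A] [NormedAlgebra ℂ A] [CompleteSpace A]
    (a b c : A) (ha : IsGDrazinInvertible a) (hb : IsGDrazinInvertible b)
    (hba : b * spectralIdem a = 0) (hc : c = a * gDrazinInv a * (a + b)) :
    (IsGDrazinInvertible (a + b) ↔ IsGDrazinInvertible c) ∧
    (IsGDrazinInvertible c ↔ IsGDrazinInvertible (a ^ 2 * gDrazinInv a + b)) ∧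
    (IsGDrazinInvertible (a + b) →
      Summable (fun n : ℕ => a ^ n * spectralIdem a * b * gDrazinInv c ^ (n + 2)) ∧
      gDrazinInv (a + b) = gDrazinInv c +
        ∑' n : ℕ, a ^ n * spectralIdem a * b * gDrazinInv c ^ (n + 2)) :=
  corollary2p3_general a b c ha hba hc
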